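/- Let $0<r<R<1$ and let $Q$ be a probability measure on $[r,R]$ such that $r$ is the infimum of the support of $Q$. For $\varepsilon\in(0,1)$ let $Q_\varepsilon=(1-\varepsilon)\delta_1+\varepsilon Q$, and let $\mathcal P_\varepsilon=\bigotimes_{x\in\mathbb Z}Q_\varepsilon$ be the law of the i.i.d. environment $\alpha=(\alpha(x))_{x\in\mathbb Z}$. For an integer $N\ge 1$ and an environment $\alpha$ with positive rates, consider the open TASEP on $\{0,1\}^{\{1,\dots,N\}}$ in which a particle at $x\in\{1,\dots,N-1\}$ jumps to $x+1$ at rate $\alpha(x)$ if $x+1$ is empty, a particle enters at site $1$ at rate $\alpha(0)$ if this site is empty, and a particle at site $N$ leaves at rate $\alpha(N)$. Let $\nu$ be the unique invariant probability measure of this process and let $$j_{\infty,[0,N]}(\alpha)=\int \alpha(0)\,(1-\eta(1))\,d\nu(\eta)$$ be its stationary current (the same at all bonds). Suppose that, for some $\kappa>1$, $Q([r,r+u))=O(u^\kappa)$ as $u\to0^+$. Then Assumption (H) holds: there exist $b\in(0,2)$, $a>0$, $c>0$, $\beta>0$ and $\varepsilon_0\in(0,1]$ such that, for every $\varepsilon\in(0,\varepsilon_0)$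 and every integer $N\ge1$, $$\mathcal P_\varepsilon\Big(j_{\infty,[0,N]}(\alpha)\le \frac r4+\frac{a}{N^{b/2}}\Big)\le\frac{c}{N^\beta}.$$ -/

import Mathlib

/-! Open TASEP with site disorder in a finite box, its maximal current, and Assumption (H). -/

namespace TASEP

/-- Particle configurations on the box `B = [x₁, x₂] ∩ ℤ` (`true` means occupied). -/
abbrev Config (x₁ x₂ : ℤ) : Type := Set.Icc x₁ x₂ → Bool

variable {x₁ x₂ : ℤ}

/-- The occupation number `η(x) ∈ {0, 1}` (it is only used at sites `x` of the box). -/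
noncomputable def occ (η : Config x₁ x₂) (x : ℤ) : ℝ :=
  if h : x ∈ Set.Icc x₁ x₂ then (if η ⟨x, h⟩ = true then 1 else 0) else 0

/-- The configuration `η` with the state of the site `x` changed to `b`. -/
def setSite (η : Config x₁ x₂) (x : ℤ) (b : Bool) : Config x₁ x₂ :=
  fun y => if (y : ℤ) = x then b else η y

/-- The configuration `η - δ_x + δ_{x+1}`, after a particle has jumped from `x` to `x + 1`. -/
def move (η : Config x₁ x₂) (x : ℤ) : Config x₁ x₂ :=
  setSite (setSite η x false) (x + 1) true

/-- The generator of the open TASEP on `B = [x₁, x₂]`: a particle jumps from `x` to `x + 1` at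
rate `α x`, enters at `x₁` at rate `α (x₁ - 1)`, and leaves from `x₂` at rate `α x₂`. -/
noncomputable def generator (α : ℤ → ℝ) (f : Config x₁ x₂ → ℝ) (η : Config x₁ x₂) : ℝ :=
  (∑ x ∈ Finset.Ico x₁ x₂, α x * occ η x * (1 - occ η (x + 1)) * (f (move η x) - f η))
    + α (x₁ - 1) * (1 - occ η x₁) * (f (setSite η x₁ true) - f η)
    + α x₂ * occ η x₂ * (f (setSite η x₂ false) - f η)

/-- `ν`, a vector of weights on the finite set of configurations, is an invariant probability
measure of the open TASEP: `∫ L f dν = 0` for every function `f`. -/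
def IsInvariant (α : ℤ → ℝ) (ν : Config x₁ x₂ → ℝ) : Prop :=
  (∀ η, 0 ≤ ν η) ∧ ∑ η, ν η = 1 ∧ ∀ f : Config x₁ x₂ → ℝ, ∑ η, ν η * generator α f η = 0

open Classical in
/-- The invariant probability measure of the open TASEP on `[x₁, x₂]`. For positive rates it
exists and is unique, see `existsUnique_isInvariant` below. -/
noncomputable def invariantMeasure (x₁ x₂ : ℤ) (α : ℤ → ℝ) : Config x₁ x₂ → ℝ :=
  if h : ∃ ν : Config x₁ x₂ → ℝ, IsInvariant α ν then h.choose else 0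

/-- The maximal current `j_{∞, B^#}(α)` with `B = [x₁, x₂]` and `B^# = [x₁ - 1, x₂]`: the
stationary current of the open TASEP on `B`, read off at the entrance (for positive rates it
is the same at every bond and at the exit, see `maxCurrent_eq_bulk_and_exit` below). -/
noncomputable def maxCurrent (x₁ x₂ : ℤ) (α : ℤ → ℝ) : ℝ :=
  ∑ η : Config x₁ x₂, invariantMeasure x₁ x₂ α η * (α (x₁ - 1) * (1 - occ η x₁))

/-! ### The law of the disorder and the assumption -/

/-- `Q_ε = (1 - ε) δ_1 + ε Q`, for `ε ∈ [0, 1]`. -/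
noncomputable def siteLaw (Q : MeasureTheory.Measure ℝ) (ε : ℝ) : MeasureTheory.Measure ℝ :=
  ENNReal.ofReal (1 - ε) • MeasureTheory.Measure.dirac 1 + ENNReal.ofReal ε • Q

/-- The law of the i.i.d. environment `(α(x))_{x ∈ ℤ}` with marginals `Q_ε`. -/
noncomputable def environmentLaw (Q : MeasureTheory.Measure ℝ) (ε : ℝ) :
    MeasureTheory.Measure (ℤ → ℝ) :=
  MeasureTheory.Measure.infinitePi (fun _ : ℤ => siteLaw Q ε)

/-- Assumption (H) for the defect law `Q` with minimal rate `r`: the probability that the maximal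
current `j_{∞, [0, N]}` (of the open TASEP on `[1, N]`) is at most `r / 4 + a / N ^ (b / 2)` is
at most `c / N ^ β`, for all `N ≥ 1` and all small `ε`. -/
def AssumptionH (r : ℝ) (Q : MeasureTheory.Measure ℝ) : Prop :=
  ∃ b a c β : ℝ, b ∈ Set.Ioo (0 : ℝ) 2 ∧ 0 < a ∧ 0 < c ∧ 0 < β ∧
    ∃ ε₀ ∈ Set.Ioc (0 : ℝ) 1, ∀ ε ∈ Set.Ioo (0 : ℝ) ε₀, ∀ N : ℕ, 1 ≤ N →
      (environmentLaw Q ε).real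
          {α : ℤ → ℝ | maxCurrent 1 (N : ℤ) α ≤ r / 4 + a / (N : ℝ) ^ (b / 2)}
        ≤ c / (N : ℝ) ^ β

/-! ### The definitions are meaningful -/

theorem isProbabilityMeasure_siteLaw (Q : MeasureTheory.Measure ℝ)
    [MeasureTheory.IsProbabilityMeasure Q] {ε : ℝ} (h0 : 0 ≤ ε) (h1 : ε ≤ 1) :
    MeasureTheory.IsProbabilityMeasure (siteLaw Q ε) := by
  constructor
  simp only [siteLaw, MeasureTheory.Measure.add_apply, MeasureTheory.Measure.smul_apply,
    MeasureTheory.measure_univ, smul_eq_mul, mul_one]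
  rw [← ENNReal.ofReal_add (by linarith) h0]
  simp

section Markov

variable {S : Type*} [Fintype S] [DecidableEq S]

theorem invariant_abs (A : Matrix S S ℝ) (hoff : ∀ s t, s ≠ t → 0 ≤ A s t)
    (hrow : ∀ s, ∑ t, A s t = 0) (v : S → ℝ) (hv : ∀ t, ∑ s, v s * A s t = 0) (t : S) :
    ∑ s, |v s| * A s t = 0 := by
  have hdiag : ∀ t, A t t ≤ 0 := by
    intro t
    have h := hrow t
    rw [← Finset.add_sum_erase _ _ (Finset.mem_univ t)] at h
    have : 0 ≤ ∑ x ∈ Finset.univ.erase t, A t x :=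
      Finset.sum_nonneg fun x hx => hoff _ _ (Finset.ne_of_mem_erase hx).symm
    linarith
  have hnn : ∀ t, 0 ≤ ∑ s, |v s| * A s t := by
    intro t
    have h := hv t
    rw [← Finset.add_sum_erase _ _ (Finset.mem_univ t)] at h ⊢
    have h1 : |∑ x ∈ Finset.univ.erase t, v x * A x t|
        ≤ ∑ x ∈ Finset.univ.erase t, |v x| * A x t := by
      refine (Finset.abs_sum_le_sum_abs _ _).trans (Finset.sum_le_sum fun x hx => ?_)
      rw [abs_mul, abs_of_nonneg (hoff _ _ (Finset.ne_of_mem_erase hx))]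
    have h2 : |∑ x ∈ Finset.univ.erase t, v x * A x t| = - (|v t| * A t t) := by
      rw [show ∑ x ∈ Finset.univ.erase t, v x * A x t = -(v t * A t t) by linarith, abs_neg,
        abs_mul, abs_of_nonpos (hdiag t)]
      ring
    linarith
  have hsum : ∑ t, ∑ s, |v s| * A s t = 0 := by
    rw [Finset.sum_comm]
    refine Finset.sum_eq_zero fun s _ => ?_
    rw [← Finset.mul_sum, hrow, mul_zero]
  exact (Finset.sum_eq_zero_iff_of_nonneg (fun t _ => hnn t)).1 hsum t (Finset.mem_univ t)

theorem invariant_eq_zero (A : Matrix S S ℝ) (hoff : ∀ s t, s ≠ t → 0 ≤ A s t)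
    (rank : S → ℕ) (s₀ : S)
    (hreach : ∀ s, s ≠ s₀ → ∃ t, rank t < rank s ∧ 0 < A s t)
    (v : S → ℝ) (hpos : ∀ s, 0 ≤ v s) (hv : ∀ t, ∑ s, v s * A s t = 0) (h0 : v s₀ = 0) :
    ∀ s, v s = 0 := by
  suffices H : ∀ n, ∀ s, rank s = n → v s = 0 from fun s => H _ s rfl
  intro n
  induction n using Nat.strong_induction_on with
  | _ n ih =>
    intro s hs
    by_cases hss : s = s₀
    · rw [hss, h0]
    obtain ⟨t, hlt, hA⟩ := hreach s hss
    have ht : v t = 0 := ih _ (hs ▸ hlt) t rfl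
    have hterm : ∀ u ∈ Finset.univ, 0 ≤ v u * A u t := by
      intro u _
      by_cases hu : u = t
      · rw [hu, ht, zero_mul]
      · exact mul_nonneg (hpos u) (hoff _ _ hu)
    have := (Finset.sum_eq_zero_iff_of_nonneg hterm).1 (hv t) s (Finset.mem_univ s)
    rcases mul_eq_zero.1 this with h | h
    · exact h
    · exact absurd h hA.ne'

theorem existsUnique_invariant (A : Matrix S S ℝ) (hoff : ∀ s t, s ≠ t → 0 ≤ A s t)
    (hrow : ∀ s, ∑ t, A s t = 0) (rank : S → ℕ) (s₀ : S)
    (hreach : ∀ s, s ≠ s₀ → ∃ t, rank t < rank s ∧ 0 < A s t) :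
    ∃! v : S → ℝ, (∀ s, 0 ≤ v s) ∧ ∑ s, v s = 1 ∧ ∀ t, ∑ s, v s * A s t = 0 := by
  have hdet : A.det = 0 := by
    rw [← Matrix.exists_mulVec_eq_zero_iff]
    refine ⟨fun _ => 1, fun h => one_ne_zero (congrFun h s₀), ?_⟩
    ext s
    simpa [Matrix.mulVec, dotProduct] using hrow s
  obtain ⟨v, hv0, hv⟩ := Matrix.exists_vecMul_eq_zero_iff.2 hdet
  have hv' : ∀ t, ∑ s, v s * A s t = 0 := fun t => by
    simpa [Matrix.vecMul, dotProduct] using congrFun hv t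
  have habs := invariant_abs A hoff hrow v hv'
  have hpos : 0 < ∑ s, |v s| := by
    refine lt_of_le_of_ne (Finset.sum_nonneg fun s _ => abs_nonneg _) fun h => hv0 ?_
    ext s
    have := (Finset.sum_eq_zero_iff_of_nonneg (fun s _ => abs_nonneg (v s))).1 h.symm s
      (Finset.mem_univ s)
    simpa using this
  refine ⟨fun s => |v s| / ∑ s, |v s|, ⟨fun s => by positivity, ?_, fun t => ?_⟩, ?_⟩
  · rw [← Finset.sum_div, div_self hpos.ne']
  · have : ∀ s, |v s| / (∑ s, |v s|) * A s t = |v s| * A s t / ∑ s, |v s| := fun s => by ring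
    simp only [this]
    rw [← Finset.sum_div, habs, zero_div]
  · suffices H : ∀ w w' : S → ℝ, ((∀ s, 0 ≤ w s) ∧ ∑ s, w s = 1 ∧ ∀ t, ∑ s, w s * A s t = 0) →
        ((∀ s, 0 ≤ w' s) ∧ ∑ s, w' s = 1 ∧ ∀ t, ∑ s, w' s * A s t = 0) → w = w' by
      intro w hw
      refine H _ _ hw ⟨fun s => by positivity, ?_, fun t => ?_⟩
      · rw [← Finset.sum_div, div_self hpos.ne']
      · have : ∀ s, |v s| / (∑ s, |v s|) * A s t = |v s| * A s t / ∑ s, |v s| := fun s => by ring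
        simp only [this]
        rw [← Finset.sum_div, habs, zero_div]
    rintro w w' ⟨-, hw1, hw⟩ ⟨-, hw1', hw'⟩
    have hu : ∀ t, ∑ s, (w s - w' s) * A s t = 0 := fun t => by
      simp only [sub_mul, Finset.sum_sub_distrib, hw, hw', sub_zero]
    have hu1 : ∑ s, (w s - w' s) = 0 := by
      rw [Finset.sum_sub_distrib, hw1, hw1', sub_self]
    have hua := invariant_abs A hoff hrow _ hu
    have key : (∀ s, |w s - w' s| - (w s - w' s) = 0) ∨ (∀ s, |w s - w' s| + (w s - w' s) = 0) := by
      rcases le_total 0 (w s₀ - w' s₀) with h | h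
      · left
        refine invariant_eq_zero A hoff rank s₀ hreach _
          (fun s => sub_nonneg.2 (le_abs_self _)) (fun t => ?_) (by rw [abs_of_nonneg h, sub_self])
        have e : ∀ s, (|w s - w' s| - (w s - w' s)) * A s t
            = |w s - w' s| * A s t - (w s - w' s) * A s t := fun s => by ring
        simp only [e]
        rw [Finset.sum_sub_distrib, hua, hu, sub_zero]
      · right
        refine invariant_eq_zero A hoff rank s₀ hreach _
          (fun s => by linarith [neg_abs_le (w s - w' s)]) (fun t => ?_)
          (by rw [abs_of_nonpos h]; ring)
        have e : ∀ s, (|w s - w' s| + (w s - w' s)) * A s t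
            = |w s - w' s| * A s t + (w s - w' s) * A s t := fun s => by ring
        simp only [e]
        rw [Finset.sum_add_distrib, hua, hu, add_zero]
    have hz : ∑ s, |w s - w' s| = 0 := by
      rcases key with h | h
      · rw [← hu1]
        exact Finset.sum_congr rfl fun s _ => by linarith [h s]
      · rw [← neg_zero, ← hu1, ← Finset.sum_neg_distrib]
        exact Finset.sum_congr rfl fun s _ => by linarith [h s]
    ext s
    have := (Finset.sum_eq_zero_iff_of_nonneg (fun s _ => abs_nonneg (w s - w' s))).1 hz s
      (Finset.mem_univ s)
    linarith [abs_eq_zero.1 this]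

end Markov

theorem occ_nonneg (η : Config x₁ x₂) (x : ℤ) : 0 ≤ occ η x := by
  unfold occ; split_ifs <;> norm_num

theorem occ_le_one (η : Config x₁ x₂) (x : ℤ) : occ η x ≤ 1 := by
  unfold occ; split_ifs <;> norm_num

theorem occ_setSite (η : Config x₁ x₂) (x y : ℤ) (b : Bool) (hx : x ∈ Set.Icc x₁ x₂) :
    occ (setSite η x b) y = if y = x then (if b = true then 1 else 0) else occ η y := by
  by_cases hyx : y = x
  · subst hyx
    simp [occ, setSite, show x₁ ≤ y ∧ y ≤ x₂ from hx]
  · simp [occ, setSite, hyx]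

/-- A strictly decreasing quantity along the dynamics without entrances. -/
noncomputable def rank (η : Config x₁ x₂) : ℕ :=
  ∑ y : Set.Icc x₁ x₂, if η y = true then (x₂ + 1 - y).toNat else 0

theorem rank_setSite_false (η : Config x₁ x₂) (x : Set.Icc x₁ x₂) (hx : η x = true) :
    rank (setSite η x false) + (x₂ + 1 - x).toNat = rank η := by
  unfold rank
  rw [← Finset.add_sum_erase _ _ (Finset.mem_univ x),
    ← Finset.add_sum_erase (f := fun y : Set.Icc x₁ x₂ =>
      if η y = true then (x₂ + 1 - (y : ℤ)).toNat else 0) _ (Finset.mem_univ x)]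
  have : ∀ y ∈ Finset.univ.erase x, (if setSite η x false y = true then (x₂ + 1 - (y : ℤ)).toNat
      else 0) = if η y = true then (x₂ + 1 - (y : ℤ)).toNat else 0 := by
    intro y hy
    have : (y : ℤ) ≠ x := fun h => Finset.ne_of_mem_erase hy (Subtype.ext h)
    simp [setSite, this]
  rw [Finset.sum_congr rfl this]
  simp [setSite, hx]
  ring

theorem rank_setSite_true (η : Config x₁ x₂) (x : Set.Icc x₁ x₂) (hx : η x = false) :
    rank (setSite η x true) = rank η + (x₂ + 1 - x).toNat := by
  have h1 := rank_setSite_false (setSite η x true) x (by simp [setSite])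
  have h2 : setSite (setSite η x true) x false = η := by
    ext y
    by_cases h : (y : ℤ) = x
    · have : y = x := Subtype.ext h
      simp [setSite, this, hx]
    · simp [setSite, h]
  rw [h2] at h1
  exact h1.symm

theorem generator_eq_sum (α : ℤ → ℝ) (f : Config x₁ x₂ → ℝ) (η : Config x₁ x₂) :
    generator α f η = ∑ ζ, f ζ * generator α (Pi.single ζ 1) η := by
  have hs : ∀ ξ : Config x₁ x₂, f ξ = ∑ ζ, f ζ * (Pi.single ζ 1 : Config x₁ x₂ → ℝ) ξ := by
    intro ξ
    simp [Pi.single_apply]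
  have h2 : ∀ (k : ℝ) (ξ : Config x₁ x₂), k * (f ξ - f η) = ∑ ζ, f ζ *
      (k * ((Pi.single ζ 1 : Config x₁ x₂ → ℝ) ξ - (Pi.single ζ 1 : Config x₁ x₂ → ℝ) η)) := by
    intro k ξ
    rw [hs ξ, hs η, ← Finset.sum_sub_distrib, Finset.mul_sum]
    exact Finset.sum_congr rfl fun ζ _ => by ring
  simp only [generator, mul_add, Finset.sum_add_distrib]
  rw [h2, h2, Finset.sum_congr rfl fun x _ => h2 _ (move η x), Finset.sum_comm]
  simp only [Finset.mul_sum]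

/-- For positive rates the open TASEP has exactly one invariant probability measure. -/
theorem existsUnique_isInvariant (α : ℤ → ℝ) (hα : ∀ x, 0 < α x) :
    ∃! ν : Config x₁ x₂ → ℝ, IsInvariant α ν := by
  classical
  let A : Matrix (Config x₁ x₂) (Config x₁ x₂) ℝ := fun η ζ => generator α (Pi.single ζ 1) η
  have hinv : ∀ ν : Config x₁ x₂ → ℝ, IsInvariant α ν ↔
      ((∀ s, 0 ≤ ν s) ∧ ∑ s, ν s = 1 ∧ ∀ t, ∑ s, ν s * A s t = 0) := by
    intro ν
    refine and_congr_right fun _ => and_congr_right fun _ => ⟨fun h t => h _, fun h f => ?_⟩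
    simp only [generator_eq_sum α f, Finset.mul_sum]
    rw [Finset.sum_comm]
    refine Finset.sum_eq_zero fun ζ _ => ?_
    have : ∀ η, ν η * (f ζ * generator α (Pi.single ζ 1) η) = f ζ * (ν η * A η ζ) :=
      fun η => by simp only [A]; ring
    simp only [this]
    rw [← Finset.mul_sum, h, mul_zero]
  have hnn : ∀ η ζ ξ : Config x₁ x₂, η ≠ ζ → 0 ≤ (Pi.single ζ 1 : Config x₁ x₂ → ℝ) ξ
      - (Pi.single ζ 1 : Config x₁ x₂ → ℝ) η := by
    intro η ζ ξ h
    simp only [Pi.single_apply, h, if_false, sub_zero]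
    split_ifs <;> norm_num
  have hone : ∀ η ζ : Config x₁ x₂, η ≠ ζ → (Pi.single ζ 1 : Config x₁ x₂ → ℝ) ζ
      - (Pi.single ζ 1 : Config x₁ x₂ → ℝ) η = 1 := by
    intro η ζ h
    simp [h]
  have hb : ∀ (η ζ : Config x₁ x₂) (x : ℤ), η ≠ ζ → 0 ≤ α x * occ η x * (1 - occ η (x + 1)) *
      ((Pi.single ζ 1 : Config x₁ x₂ → ℝ) (move η x) - (Pi.single ζ 1 : Config x₁ x₂ → ℝ) η) :=
    fun η ζ x h => mul_nonneg (mul_nonneg (mul_nonneg (hα x).le (occ_nonneg _ _))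
      (sub_nonneg.2 (occ_le_one _ _))) (hnn _ _ _ h)
  have hl : ∀ (η ζ : Config x₁ x₂), η ≠ ζ → 0 ≤ α (x₁ - 1) * (1 - occ η x₁) *
      ((Pi.single ζ 1 : Config x₁ x₂ → ℝ) (setSite η x₁ true)
        - (Pi.single ζ 1 : Config x₁ x₂ → ℝ) η) :=
    fun η ζ h => mul_nonneg (mul_nonneg (hα _).le (sub_nonneg.2 (occ_le_one _ _))) (hnn _ _ _ h)
  have hr : ∀ (η ζ : Config x₁ x₂), η ≠ ζ → 0 ≤ α x₂ * occ η x₂ *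
      ((Pi.single ζ 1 : Config x₁ x₂ → ℝ) (setSite η x₂ false)
        - (Pi.single ζ 1 : Config x₁ x₂ → ℝ) η) :=
    fun η ζ h => mul_nonneg (mul_nonneg (hα _).le (occ_nonneg _ _)) (hnn _ _ _ h)
  have key := existsUnique_invariant A
    (fun η ζ h => add_nonneg (add_nonneg (Finset.sum_nonneg fun x _ => hb η ζ x h) (hl η ζ h))
      (hr η ζ h))
    (fun η => by
      have h := generator_eq_sum α (fun _ => 1) η
      simp only [one_mul] at h
      rw [show ∑ t, A η t = generator α (fun _ => 1) η from h.symm]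
      simp [generator])
    rank (fun _ => false) (fun η hη => by
      have hne : (Finset.univ.filter fun y : Set.Icc x₁ x₂ => η y = true).Nonempty := by
        by_contra hcon
        apply hη
        ext y
        rw [Finset.not_nonempty_iff_eq_empty] at hcon
        have := Finset.filter_eq_empty_iff.1 hcon (Finset.mem_univ y)
        simpa using this
      obtain ⟨y, hy⟩ := Finset.exists_maximal hne
      have hyt : η y = true := by simpa using hy.prop
      have hmax : ∀ z : Set.Icc x₁ x₂, y < z → η z = false := by
        intro z hz
        by_contra hzt
        exact absurd (hy.le_of_ge (by simpa using hzt) hz.le) (not_le.2 hz)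
      have hocc : occ η (y : ℤ) = 1 := by
        simp [occ, hyt]
      have hr1 := rank_setSite_false η y hyt
      have hy2 := y.2.2
      rcases eq_or_lt_of_le hy2 with he | hlt
      · have hrk : rank (setSite η (y : ℤ) false) < rank η := by omega
        have hocc2 : occ η x₂ = 1 := (congrArg (occ η) he).symm.trans hocc
        have hrk2 : rank (setSite η x₂ false) < rank η := (congrArg (fun z =>
          rank (setSite η z false)) he).symm.trans_lt hrk
        have hneq : η ≠ setSite η x₂ false := fun h => by
          rw [← h] at hrk2; exact lt_irrefl _ hrk2
        refine ⟨setSite η x₂ false, hrk2, ?_⟩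
        refine add_pos_of_nonneg_of_pos (add_nonneg (Finset.sum_nonneg fun x _ => hb _ _ x hneq)
          (hl _ _ hneq)) ?_
        rw [hone _ _ hneq, hocc2]
        simpa using hα x₂
      · have hy1 := y.2.1
        have hmem : (y : ℤ) + 1 ∈ Set.Icc x₁ x₂ := ⟨by omega, by omega⟩
        have hfree : η ⟨(y : ℤ) + 1, hmem⟩ = false :=
          hmax _ (Subtype.coe_lt_coe.1 (by simp))
        have hr2 := rank_setSite_true (setSite η (y : ℤ) false) ⟨(y : ℤ) + 1, hmem⟩
          (by simp [setSite, hfree])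
        have hrk : rank (move η y) < rank η := by
          change rank (move η y) = _ at hr2
          simp only at hr2
          omega
        have hneq : η ≠ move η y := fun h => by
          rw [← h] at hrk; exact lt_irrefl _ hrk
        have hocc' : occ η ((y : ℤ) + 1) = 0 := by
          simp only [occ, hmem, hfree]
          simp
        refine ⟨move η y, hrk, ?_⟩
        refine add_pos_of_pos_of_nonneg (add_pos_of_pos_of_nonneg ?_ (hl _ _ hneq)) (hr _ _ hneq)
        refine Finset.sum_pos' (fun x _ => hb _ _ x hneq)
          ⟨y, Finset.mem_Ico.2 ⟨hy1, hlt⟩, ?_⟩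
        rw [hone _ _ hneq, hocc, hocc']
        simpa using hα y)
  exact (existsUnique_congr hinv).2 key

theorem isInvariant_invariantMeasure (α : ℤ → ℝ) (hα : ∀ x, 0 < α x) :
    IsInvariant α (invariantMeasure x₁ x₂ α) := by
  have h := (existsUnique_isInvariant (x₁ := x₁) (x₂ := x₂) α hα).exists
  rw [invariantMeasure, dif_pos h]
  exact h.choose_spec

theorem occ_mul_self (η : Config x₁ x₂) (x : ℤ) : occ η x * occ η x = occ η x := by
  unfold occ; split_ifs <;> norm_num

theorem generator_occ (α : ℤ → ℝ) (h12 : x₁ ≤ x₂) (η : Config x₁ x₂) (z : ℤ) :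
    generator α (fun ξ => occ ξ z) η
      = (if z - 1 ∈ Finset.Ico x₁ x₂ then α (z - 1) * occ η (z - 1) * (1 - occ η z) else 0)
        - (if z ∈ Finset.Ico x₁ x₂ then α z * occ η z * (1 - occ η (z + 1)) else 0)
        + (if z = x₁ then α (x₁ - 1) * (1 - occ η x₁) else 0)
        - (if z = x₂ then α x₂ * occ η x₂ else 0) := by
  have hterm : ∀ w ∈ Finset.Ico x₁ x₂,
      α w * occ η w * (1 - occ η (w + 1)) * (occ (move η w) z - occ η z)
        = (if z - 1 = w then α w * occ η w * (1 - occ η (w + 1)) else 0)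
          - (if z = w then α w * occ η w * (1 - occ η (w + 1)) else 0) := by
    intro w hw
    rw [Finset.mem_Ico] at hw
    rw [move, occ_setSite _ _ _ _ ⟨by omega, by omega⟩, occ_setSite _ _ _ _ ⟨hw.1, hw.2.le⟩]
    by_cases h1 : z = w + 1
    · subst h1
      simp only [if_true, add_sub_cancel_right, if_neg (show w + 1 ≠ w by omega)]
      linear_combination (α w * occ η w) * occ_mul_self η (w + 1)
    · by_cases h2 : z = w
      · subst h2
        simp only [h1, if_false, if_true, if_neg (show z - 1 ≠ z by omega), Bool.false_eq_true]
        linear_combination (-(α z * (1 - occ η (z + 1)))) * occ_mul_self η z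
      · simp [h1, h2, show z - 1 ≠ w by omega]
  have hin : α (x₁ - 1) * (1 - occ η x₁) * (occ (setSite η x₁ true) z - occ η z)
      = if z = x₁ then α (x₁ - 1) * (1 - occ η x₁) else 0 := by
    rw [occ_setSite _ _ _ _ ⟨le_rfl, h12⟩]
    by_cases h : z = x₁
    · rw [h]
      simp only [if_true]
      linear_combination α (x₁ - 1) * occ_mul_self η x₁
    · simp [h]
  have hout : α x₂ * occ η x₂ * (occ (setSite η x₂ false) z - occ η z)
      = - if z = x₂ then α x₂ * occ η x₂ else 0 := by
    rw [occ_setSite _ _ _ _ ⟨h12, le_rfl⟩]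
    by_cases h : z = x₂
    · rw [h]
      simp only [if_true, Bool.false_eq_true, if_false]
      linear_combination (-α x₂) * occ_mul_self η x₂
    · simp [h]
  rw [generator, Finset.sum_congr rfl hterm, Finset.sum_sub_distrib, Finset.sum_ite_eq,
    Finset.sum_ite_eq, hin, hout, sub_add_cancel]
  ring

/-- The stationary current is the same at every bond of the box, and at the exit. -/
theorem maxCurrent_eq_bulk_and_exit (h12 : x₁ ≤ x₂) (α : ℤ → ℝ) (hα : ∀ x, 0 < α x) :
    (∀ x ∈ Finset.Ico x₁ x₂, maxCurrent x₁ x₂ α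
      = ∑ η : Config x₁ x₂, invariantMeasure x₁ x₂ α η * (α x * occ η x * (1 - occ η (x + 1)))) ∧
    maxCurrent x₁ x₂ α
      = ∑ η : Config x₁ x₂, invariantMeasure x₁ x₂ α η * (α x₂ * occ η x₂) := by
  have hI := (isInvariant_invariantMeasure (x₁ := x₁) (x₂ := x₂) α hα).2.2
  have hbal : ∀ z,
      (if z - 1 ∈ Finset.Ico x₁ x₂ then ∑ η : Config x₁ x₂, invariantMeasure x₁ x₂ α η *
          (α (z - 1) * occ η (z - 1) * (1 - occ η z)) else 0)
        - (if z ∈ Finset.Ico x₁ x₂ then ∑ η : Config x₁ x₂, invariantMeasure x₁ x₂ α η *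
          (α z * occ η z * (1 - occ η (z + 1))) else 0)
        + (if z = x₁ then maxCurrent x₁ x₂ α else 0)
        - (if z = x₂ then ∑ η : Config x₁ x₂, invariantMeasure x₁ x₂ α η *
          (α x₂ * occ η x₂) else 0) = 0 := by
    intro z
    refine Eq.trans ?_ (hI fun ξ => occ ξ z)
    have hsplit : ∀ (ν a b c d : ℝ), ν * (a - b + c - d) = ν * a - ν * b + ν * c - ν * d :=
      fun ν a b c d => by ring
    simp only [generator_occ α h12, hsplit, Finset.sum_add_distrib, Finset.sum_sub_distrib,
      maxCurrent, mul_ite, mul_zero]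
    split_ifs <;> simp only [Finset.sum_const_zero]
  have hbulk : ∀ n : ℕ, x₁ + n < x₂ → maxCurrent x₁ x₂ α
      = ∑ η : Config x₁ x₂, invariantMeasure x₁ x₂ α η *
        (α (x₁ + n) * occ η (x₁ + n) * (1 - occ η (x₁ + n + 1))) := by
    intro n
    induction n with
    | zero =>
      intro h
      simp only [Nat.cast_zero, add_zero] at h ⊢
      have := hbal x₁
      rw [if_neg (by simp), if_pos (by simp [h]), if_pos rfl, if_neg h.ne] at this
      linarith
    | succ n ih =>
      intro h
      push_cast at h ⊢
      have := hbal (x₁ + (n + 1))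
      rw [if_pos (Finset.mem_Ico.2 ⟨by omega, by omega⟩),
        if_pos (Finset.mem_Ico.2 ⟨by omega, by omega⟩), if_neg (by omega), if_neg (by omega),
        show x₁ + ((n : ℤ) + 1) - 1 = x₁ + n by ring] at this
      have h2 := ih (by omega)
      rw [add_assoc] at h2
      linarith
  have hbulk' : ∀ x ∈ Finset.Ico x₁ x₂, maxCurrent x₁ x₂ α
      = ∑ η : Config x₁ x₂, invariantMeasure x₁ x₂ α η *
        (α x * occ η x * (1 - occ η (x + 1))) := by
    intro x hx
    rw [Finset.mem_Ico] at hx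
    have h := hbulk (x - x₁).toNat (by omega)
    rwa [show x₁ + (((x - x₁).toNat : ℕ) : ℤ) = x by omega] at h
  refine ⟨hbulk', ?_⟩
  have := hbal x₂
  rw [if_neg (show ¬ x₂ ∈ Finset.Ico x₁ x₂ by simp), if_pos rfl] at this
  rcases eq_or_lt_of_le h12 with h | h
  · rw [if_neg (by simp [h]), if_pos h.symm] at this
    linarith
  · rw [if_pos (Finset.mem_Ico.2 ⟨by omega, by omega⟩), if_neg h.ne'] at this
    have h2 := hbulk' (x₂ - 1) (Finset.mem_Ico.2 ⟨by omega, by omega⟩)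
    rw [sub_add_cancel] at h2
    linarith

end TASEP

/-! The current is a nondecreasing function of the rates (`stationaryCurrent_mono`). With bulk rates
`s` and boundary rates `s / 2`, the Bernoulli measure of density `1 / 2` is invariant and has
current `s / 4`. Hence the current is at least `s / 4` whenever all rates are at least `s`
(`div_four_le_maxCurrent`), and a current below `(r + u) / 4` forces a rate below `r + u` at one of
the `N + 1` sites. By a union bound this has probability at most `(N + 1) Q([r, r + u)) = O(N u ^
κ)`, uniformly in `ε`. Since `κ > 1`, some `u` of order `N ^ (-b / 2)` with `b < 2` still makes this
a negative power of `N`.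

Monotonicity is the attractiveness of TASEP in terms of heights, the integrated currents through the
bonds. It is proved without constructing a coupling: one-step averaging operators act on functions
of the configuration, the expected numbers of future entrances. They preserve `HeightMonotone`, and
on such functions they increase with the rates. Dividing by time gives the order of the stationary
currents. -/

namespace TASEP

/-! ### Monotonicity of the current in the rates -/

section Monotonicity

variable {x₁ x₂ : ℤ}

/-- The occupation number as an integer. -/
noncomputable def occInt (η : Config x₁ x₂) (x : ℤ) : ℤ :=
  if h : x ∈ Set.Icc x₁ x₂ then (if η ⟨x, h⟩ = true then 1 else 0) else 0

theorem occ_eq_occInt (η : Config x₁ x₂) (x : ℤ) : occ η x = (occInt η x : ℝ) := by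
  unfold occ occInt; split_ifs <;> norm_num

theorem occInt_nonneg (η : Config x₁ x₂) (x : ℤ) : 0 ≤ occInt η x := by
  unfold occInt; split_ifs <;> norm_num

theorem occInt_le_one (η : Config x₁ x₂) (x : ℤ) : occInt η x ≤ 1 := by
  unfold occInt; split_ifs <;> norm_num

theorem occInt_of_notMem (η : Config x₁ x₂) {x : ℤ} (h : x ∉ Set.Icc x₁ x₂) : occInt η x = 0 := by
  simp only [occInt, dif_neg h]

theorem occInt_setSite (η : Config x₁ x₂) (x y : ℤ) (b : Bool) (hy : y ∈ Set.Icc x₁ x₂) :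
    occInt (setSite η x b) y = if y = x then (if b = true then 1 else 0) else occInt η y := by
  simp only [occInt, dif_pos hy, setSite]
  split_ifs <;> rfl

/-! ### Heights and their domination order. -/

/-- The number of particles in `[x₁, x]`. -/
noncomputable def mass (η : Config x₁ x₂) (x : ℤ) : ℤ := ∑ y ∈ Finset.Icc x₁ x, occInt η y

theorem mass_pred_left (η : Config x₁ x₂) : mass η (x₁ - 1) = 0 := by
  simp [mass]

theorem mass_succ (η : Config x₁ x₂) {x : ℤ} (hx : x₁ - 1 ≤ x) :
    mass η (x + 1) = mass η x + occInt η (x + 1) := by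
  unfold mass
  have : Finset.Icc x₁ (x + 1) = insert (x + 1) (Finset.Icc x₁ x) := by
    ext y; simp only [Finset.mem_Icc, Finset.mem_insert]; omega
  rw [this, Finset.sum_insert (by simp), add_comm]

theorem mass_nonneg (η : Config x₁ x₂) (x : ℤ) : 0 ≤ mass η x :=
  Finset.sum_nonneg fun y _ => occInt_nonneg η y

theorem mass_le (η : Config x₁ x₂) {x : ℤ} (hx : x₁ - 1 ≤ x) : mass η x ≤ x + 1 - x₁ := by
  have h : mass η x ≤ ∑ _y ∈ Finset.Icc x₁ x, (1 : ℤ) :=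
    Finset.sum_le_sum fun y _ => occInt_le_one η y
  simp only [Finset.sum_const, Int.card_Icc, nsmul_eq_mul, mul_one] at h
  omega

/-- The bond from `x` to `x + 1` can be crossed (with reservoirs outside the box). -/
def CanJump (η : Config x₁ x₂) (x : ℤ) : Prop :=
  (x₁ ≤ x → occInt η x = 1) ∧ occInt η (x + 1) = 0

/-- The number of particles that enter the box in a jump across the bond from `x` to `x + 1`. -/
def entering (x₁ x : ℤ) : ℤ := if x = x₁ - 1 then 1 else 0

/-- Entrances minus `mass η z` count the crossings of the bond at `z`, up to a constant, so a jump
at `x` affects this difference at `z = x` only. In `Dominates d η η'`, the shift `d` is the lead of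
`η'` over `η` in entrances already made. -/
theorem mass_move (η : Config x₁ x₂) {x z : ℤ} (hx : x₁ - 1 ≤ x) (hz : x₁ - 1 ≤ z) (hz2 : z ≤ x₂)
    (h : CanJump η x) :
    mass (move η x) z = mass η z - (if z = x then 1 else 0) + entering x₁ x := by
  induction z, hz using Int.leInduction with
  | base =>
    simp only [mass_pred_left, entering, eq_comm (a := x)]
    split_ifs <;> simp
  | succ z hz ih =>
    rw [mass_succ _ hz, mass_succ _ hz, ih (by omega)]
    have hm : z + 1 ∈ Set.Icc x₁ x₂ := ⟨by omega, hz2⟩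
    rw [move, occInt_setSite _ _ _ _ hm, occInt_setSite _ _ _ _ hm]
    by_cases h1 : z = x
    · subst h1
      simp [h.2]
      ring
    · by_cases h2 : z + 1 = x
      · subst h2
        simp [h.1 (by omega)]
      · simp [h1, h2]
        ring

/-- `η'` has let through at least as many particles as `η` at every bond, up to a shift `d`. -/
def Dominates (d : ℤ) (η η' : Config x₁ x₂) : Prop :=
  ∀ z, x₁ - 1 ≤ z → z ≤ x₂ → mass η' z ≤ mass η z + d

/-- Monotonicity of an expected number of entrances with respect to the initial heights. -/
def HeightMonotone (f : Config x₁ x₂ → ℝ) : Prop :=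
  ∀ (d : ℤ) (η η' : Config x₁ x₂), Dominates d η η' → f η ≤ d + f η'

/-- Any two configurations are comparable at a cost bounded by the size of the box. This makes the
initial configuration irrelevant in the long run. -/
theorem dominates_card (η η' : Config x₁ x₂) :
    Dominates (x₂ + 1 - x₁) η η' := by
  intro z hz hz2
  have := mass_le η' hz
  have := mass_nonneg η z
  omega

/-! ### Attempted jumps and attractiveness. -/

open Classical in
/-- The value of `f`, plus the number of entrances, after an attempt to cross the bond at `x`. -/
noncomputable def attempt (x : ℤ) (f : Config x₁ x₂ → ℝ) (η : Config x₁ x₂) : ℝ :=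
  if CanJump η x then f (move η x) + entering x₁ x else f η

theorem attempt_mono (x : ℤ) {f g : Config x₁ x₂ → ℝ} (hfg : ∀ η, f η ≤ g η) (η : Config x₁ x₂) :
    attempt x f η ≤ attempt x g η := by
  unfold attempt
  split_ifs
  · linarith [hfg (move η x)]
  · exact hfg η

theorem HeightMonotone.le_attempt {f : Config x₁ x₂ → ℝ} (hf : HeightMonotone f) {x : ℤ}
    (hx : x₁ - 1 ≤ x) (η : Config x₁ x₂) : f η ≤ attempt x f η := by
  unfold attempt
  split_ifs with h
  · rw [add_comm]
    refine hf _ _ _ fun z hz hz2 => ?_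
    rw [mass_move η hx hz hz2 h]
    split_ifs <;> omega
  · exact le_rfl

/-- Where the two heights touch, their order at `x - 1` and `x + 1` forces `η'` to have at least the
occupation of `η` at `x` and at most that at `x + 1`. Outside the box `occInt` is `0`, which is the
empty reservoir on the right. -/
theorem canJump_of_mass_eq {d : ℤ} {η η' : Config x₁ x₂} (hd : Dominates d η η') {x : ℤ}
    (hx : x₁ - 1 ≤ x) (hx2 : x ≤ x₂) (h : CanJump η x) (he : mass η' x = mass η x + d) :
    CanJump η' x := by
  constructor
  · intro h1
    have a1 := mass_succ η (x := x - 1) (by omega)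
    have a2 := mass_succ η' (x := x - 1) (by omega)
    rw [sub_add_cancel] at a1 a2
    have a3 := h.1 h1
    have a4 := hd (x - 1) (by omega) (by omega)
    have a5 := occInt_le_one η' x
    omega
  · by_cases h2 : x + 1 ≤ x₂
    · have a1 := mass_succ η hx
      have a2 := mass_succ η' hx
      have a3 := h.2
      have a4 := hd (x + 1) (by omega) h2
      have a5 := occInt_nonneg η' (x + 1)
      omega
    · exact occInt_of_notMem _ fun h => h2 h.2

/-- This is the basic coupling, with the same bond attempted in both systems. If only `η` jumps, the
heights do not touch at `x`, and the unit gap there absorbs the jump. -/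
theorem HeightMonotone.attempt {f : Config x₁ x₂ → ℝ} (hf : HeightMonotone f) {x : ℤ}
    (hx : x₁ - 1 ≤ x) (hx2 : x ≤ x₂) : HeightMonotone (attempt x f) := by
  intro d η η' hd
  by_cases h : CanJump η x
  · by_cases h' : CanJump η' x
    · simp only [TASEP.attempt, if_pos h, if_pos h']
      have : f (move η x) ≤ d + f (move η' x) := by
        refine hf _ _ _ fun z hz hz2 => ?_
        rw [mass_move η hx hz hz2 h, mass_move η' hx hz hz2 h']
        have := hd z hz hz2
        omega
      linarith
    · simp only [TASEP.attempt, if_pos h, if_neg h']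
      have : f (move η x) ≤ ((d - entering x₁ x : ℤ) : ℝ) + f η' := by
        refine hf _ _ _ fun z hz hz2 => ?_
        rw [mass_move η hx hz hz2 h]
        have h1 := hd z hz hz2
        split_ifs with hzx
        · subst hzx
          have : mass η' z ≠ mass η z + d := fun he => h' (canJump_of_mass_eq hd hx hx2 h he)
          omega
        · omega
      push_cast at this
      linarith
  · refine le_trans ?_ (add_le_add_right (hf.le_attempt hx η') _)
    simp only [TASEP.attempt, if_neg h]
    exact hf _ _ _ hd

/-! ### Time-discretised dynamics. -/

/-- One step of the discretised dynamics, on expected numbers of entrances. -/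
noncomputable def step (α : ℤ → ℝ) (τ : ℝ) (f : Config x₁ x₂ → ℝ) (η : Config x₁ x₂) : ℝ :=
  f η + τ * (generator α f η + α (x₁ - 1) * (1 - occ η x₁))

theorem setSite_of_notMem (η : Config x₁ x₂) {x : ℤ} (h : x ∉ Set.Icc x₁ x₂) (b : Bool) :
    setSite η x b = η := by
  funext y
  have : (y : ℤ) ≠ x := fun e => h (e ▸ y.2)
  simp [setSite, this]

theorem occInt_eq_zero_or_one (η : Config x₁ x₂) (x : ℤ) : occInt η x = 0 ∨ occInt η x = 1 := by
  have := occInt_nonneg η x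
  have := occInt_le_one η x
  omega

/-- The last summand comes from `entering`; it is the current term that `step` adds to the
generator. -/
theorem attempt_entrance (f : Config x₁ x₂ → ℝ) (η : Config x₁ x₂) :
    attempt (x₁ - 1) f η - f η
      = (1 - occ η x₁) * (f (setSite η x₁ true) - f η) + (1 - occ η x₁) := by
  have hm : move η (x₁ - 1) = setSite η x₁ true := by
    rw [move, setSite_of_notMem η (fun h => by have := h.1; omega), sub_add_cancel]
  rw [attempt, hm, occ_eq_occInt]
  rcases occInt_eq_zero_or_one η x₁ with h | h <;> simp [CanJump, entering, h]
  ring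

theorem attempt_bulk (f : Config x₁ x₂ → ℝ) (η : Config x₁ x₂) {x : ℤ} (hx : x₁ ≤ x) :
    attempt x f η - f η = occ η x * (1 - occ η (x + 1)) * (f (move η x) - f η) := by
  rw [attempt, occ_eq_occInt, occ_eq_occInt]
  rcases occInt_eq_zero_or_one η x with h | h <;>
    rcases occInt_eq_zero_or_one η (x + 1) with h' | h' <;>
    simp [CanJump, entering, h, h', hx, show x ≠ x₁ - 1 by omega]

theorem attempt_exit (h12 : x₁ ≤ x₂) (f : Config x₁ x₂ → ℝ) (η : Config x₁ x₂) :
    attempt x₂ f η - f η = occ η x₂ * (f (setSite η x₂ false) - f η) := by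
  have hn : x₂ + 1 ∉ Set.Icc x₁ x₂ := fun h => by have := h.2; omega
  rw [attempt_bulk f η h12, move, setSite_of_notMem _ hn, occ_eq_occInt η (x₂ + 1),
    occInt_of_notMem η hn]
  simp

theorem step_eq_attempt (h12 : x₁ ≤ x₂) (α : ℤ → ℝ) (τ : ℝ) (f : Config x₁ x₂ → ℝ)
    (η : Config x₁ x₂) :
    step α τ f η = f η + τ * ∑ x ∈ Finset.Icc (x₁ - 1) x₂, α x * (attempt x f η - f η) := by
  have h : Finset.Icc (x₁ - 1) x₂ = insert (x₁ - 1) (insert x₂ (Finset.Ico x₁ x₂)) := by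
    ext y; simp only [Finset.mem_Icc, Finset.mem_insert, Finset.mem_Ico]; omega
  have hb : ∑ x ∈ Finset.Ico x₁ x₂, α x * (attempt x f η - f η)
      = ∑ x ∈ Finset.Ico x₁ x₂, α x * occ η x * (1 - occ η (x + 1)) * (f (move η x) - f η) :=
    Finset.sum_congr rfl fun x hx => by rw [attempt_bulk f η (Finset.mem_Ico.1 hx).1]; ring
  rw [step, generator, h, Finset.sum_insert, Finset.sum_insert (by simp), attempt_entrance,
    attempt_exit h12, hb]
  · ring
  · simp only [Finset.mem_insert, Finset.mem_Ico]; omega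

/-- Uniformisation: for nonnegative rates and `0 ≤ τ` with `τ ∑ α ≤ 1`, this is an average of `f`
and its attempts, so it inherits their monotonicity. -/
theorem step_eq_convex (h12 : x₁ ≤ x₂) (α : ℤ → ℝ) (τ : ℝ) (f : Config x₁ x₂ → ℝ)
    (η : Config x₁ x₂) :
    step α τ f η = (1 - τ * ∑ x ∈ Finset.Icc (x₁ - 1) x₂, α x) * f η
      + τ * ∑ x ∈ Finset.Icc (x₁ - 1) x₂, α x * attempt x f η := by
  rw [step_eq_attempt h12]
  simp only [mul_sub, Finset.sum_sub_distrib, ← Finset.sum_mul]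
  ring

theorem step_mono (h12 : x₁ ≤ x₂) {α : ℤ → ℝ} (hα : ∀ x ∈ Finset.Icc (x₁ - 1) x₂, 0 ≤ α x)
    {τ : ℝ} (hτ : 0 ≤ τ) (hτ1 : τ * ∑ x ∈ Finset.Icc (x₁ - 1) x₂, α x ≤ 1)
    {f g : Config x₁ x₂ → ℝ} (hfg : ∀ η, f η ≤ g η) (η : Config x₁ x₂) :
    step α τ f η ≤ step α τ g η := by
  rw [step_eq_convex h12, step_eq_convex h12]
  exact add_le_add (mul_le_mul_of_nonneg_left (hfg η) (by linarith))
    (mul_le_mul_of_nonneg_left (Finset.sum_le_sum fun x hx =>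
      mul_le_mul_of_nonneg_left (attempt_mono x hfg η) (hα x hx)) hτ)

theorem HeightMonotone.step (h12 : x₁ ≤ x₂) {α : ℤ → ℝ}
    (hα : ∀ x ∈ Finset.Icc (x₁ - 1) x₂, 0 ≤ α x) {τ : ℝ} (hτ : 0 ≤ τ)
    (hτ1 : τ * ∑ x ∈ Finset.Icc (x₁ - 1) x₂, α x ≤ 1)
    {f : Config x₁ x₂ → ℝ} (hf : HeightMonotone f) : HeightMonotone (step α τ f) := by
  intro d η η' hd
  rw [step_eq_convex h12, step_eq_convex h12]
  have h1 := mul_le_mul_of_nonneg_left (hf d η η' hd) (sub_nonneg.2 hτ1)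
  have h2 : τ * ∑ x ∈ Finset.Icc (x₁ - 1) x₂, α x * TASEP.attempt x f η
      ≤ τ * ∑ x ∈ Finset.Icc (x₁ - 1) x₂, α x * (d + TASEP.attempt x f η') := by
    refine mul_le_mul_of_nonneg_left (Finset.sum_le_sum fun x hx =>
      mul_le_mul_of_nonneg_left ?_ (hα x hx)) hτ
    rw [Finset.mem_Icc] at hx
    exact hf.attempt hx.1 hx.2 d η η' hd
  simp only [mul_add, Finset.sum_add_distrib, ← Finset.sum_mul] at h1 h2 ⊢
  linarith

/-- Larger rates mean more attempts, and by `le_attempt` no attempt lowers a height-monotone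
function. -/
theorem HeightMonotone.step_le_step (h12 : x₁ ≤ x₂) {α β : ℤ → ℝ}
    (hαβ : ∀ x ∈ Finset.Icc (x₁ - 1) x₂, α x ≤ β x) {τ : ℝ} (hτ : 0 ≤ τ)
    {f : Config x₁ x₂ → ℝ} (hf : HeightMonotone f) (η : Config x₁ x₂) :
    TASEP.step α τ f η ≤ TASEP.step β τ f η := by
  rw [step_eq_attempt h12, step_eq_attempt h12]
  gcongr with x hx
  · exact sub_nonneg.2 (hf.le_attempt (Finset.mem_Icc.1 hx).1 η)
  · exact hαβ x hx

/-! ### Long-time comparison of stationary currents. -/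

theorem heightMonotone_zero (h12 : x₁ ≤ x₂) :
    HeightMonotone (fun _ : Config x₁ x₂ => (0 : ℝ)) := by
  intro d η η' hd
  -- Both masses vanish at `x₁ - 1`, so domination forces `0 ≤ d`.
  have h := hd (x₁ - 1) le_rfl (by omega)
  rw [mass_pred_left, mass_pred_left] at h
  have : (0 : ℝ) ≤ d := by exact_mod_cast (by omega : 0 ≤ d)
  linarith

/-- The iterate is the expected number of entrances in `n` steps. Invariance kills the generator
term, so each step contributes exactly `τ` times the current. -/
theorem sum_invariant_iterate_step {α : ℤ → ℝ} {ν : Config x₁ x₂ → ℝ} (hν : IsInvariant α ν)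
    (τ : ℝ) (n : ℕ) :
    ∑ η, ν η * (step α τ)^[n] (fun _ => 0) η
      = n * (τ * ∑ η, ν η * (α (x₁ - 1) * (1 - occ η x₁))) := by
  induction n with
  | zero => simp
  | succ n ih =>
    rw [Function.iterate_succ_apply']
    set f := (step α τ)^[n] (fun _ => 0)
    have h : ∀ η, ν η * step α τ f η = ν η * f η + τ * (ν η * generator α f η)
        + τ * (ν η * (α (x₁ - 1) * (1 - occ η x₁))) := fun η => by rw [step]; ring
    rw [Finset.sum_congr rfl fun η _ => h η, Finset.sum_add_distrib, Finset.sum_add_distrib,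
      ← Finset.mul_sum, ← Finset.mul_sum, hν.2.2 f, ih]
    push_cast
    ring

/-- The stationary current is nondecreasing in the jump rates. -/
theorem stationaryCurrent_mono (h12 : x₁ ≤ x₂) {α β : ℤ → ℝ}
    (hα : ∀ x ∈ Finset.Icc (x₁ - 1) x₂, 0 ≤ α x)
    (hαβ : ∀ x ∈ Finset.Icc (x₁ - 1) x₂, α x ≤ β x) {μ ν : Config x₁ x₂ → ℝ}
    (hμ : IsInvariant α μ) (hν : IsInvariant β ν) :
    ∑ η, μ η * (α (x₁ - 1) * (1 - occ η x₁)) ≤ ∑ η, ν η * (β (x₁ - 1) * (1 - occ η x₁)) := by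
  have hβ : ∀ x ∈ Finset.Icc (x₁ - 1) x₂, 0 ≤ β x := fun x hx => (hα x hx).trans (hαβ x hx)
  have hS0 : 0 ≤ ∑ x ∈ Finset.Icc (x₁ - 1) x₂, β x := Finset.sum_nonneg hβ
  have hSle : ∑ x ∈ Finset.Icc (x₁ - 1) x₂, α x ≤ ∑ x ∈ Finset.Icc (x₁ - 1) x₂, β x :=
    Finset.sum_le_sum hαβ
  set S := ∑ x ∈ Finset.Icc (x₁ - 1) x₂, β x
  -- A step small enough for both sets of rates; the `+ 1` keeps the denominator positive.
  set τ : ℝ := 1 / (S + 1)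
  have hτ : 0 < τ := by positivity
  have hτβ : τ * S ≤ 1 := by
    rw [one_div_mul_eq_div, div_le_one (by positivity)]; linarith
  have hτα : τ * ∑ x ∈ Finset.Icc (x₁ - 1) x₂, α x ≤ 1 :=
    (mul_le_mul_of_nonneg_left hSle hτ.le).trans hτβ
  have hmono : ∀ n : ℕ, HeightMonotone ((step α τ)^[n] (fun _ : Config x₁ x₂ => 0)) := by
    intro n
    induction n with
    | zero => exact heightMonotone_zero h12
    | succ n ih => rw [Function.iterate_succ_apply']; exact ih.step h12 hα hτ.le hτα
  have hcmp : ∀ (n : ℕ) (η : Config x₁ x₂),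
      (step α τ)^[n] (fun _ => 0) η ≤ (step β τ)^[n] (fun _ => 0) η := by
    intro n
    induction n with
    | zero => exact fun η => le_rfl
    | succ n ih =>
      intro η
      rw [Function.iterate_succ_apply', Function.iterate_succ_apply']
      exact ((hmono n).step_le_step h12 hαβ hτ.le η).trans (step_mono h12 hβ hτ.le hτβ ih η)
  set jα := ∑ η, μ η * (α (x₁ - 1) * (1 - occ η x₁))
  set jβ := ∑ η, ν η * (β (x₁ - 1) * (1 - occ η x₁))
  set D : ℝ := ((x₂ + 1 - x₁ : ℤ) : ℝ)
  -- The bound `D` does not depend on `n`, which rules out `jα > jβ`.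
  have hkey : ∀ n : ℕ, n * (τ * (jα - jβ)) ≤ D := by
    intro n
    have e1 := sum_invariant_iterate_step hμ τ n
    have e2 := sum_invariant_iterate_step hν τ n
    have h1 : ∑ η, ν η * (step α τ)^[n] (fun _ => 0) η ≤ n * (τ * jβ) := by
      rw [← e2]
      exact Finset.sum_le_sum fun η _ => mul_le_mul_of_nonneg_left (hcmp n η) (hν.1 η)
    -- Replacing the start under `μ` by an arbitrary `ζ` costs at most `D`; then `ζ` can be averaged
    -- under `ν`.
    have h2 : ∀ ζ : Config x₁ x₂, n * (τ * jα) ≤ D + (step α τ)^[n] (fun _ => 0) ζ := by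
      intro ζ
      rw [← e1]
      calc _ ≤ ∑ η, μ η * (D + (step α τ)^[n] (fun _ => 0) ζ) :=
            Finset.sum_le_sum fun η _ => mul_le_mul_of_nonneg_left
              (hmono n _ _ _ (dominates_card η ζ)) (hμ.1 η)
        _ = _ := by rw [← Finset.sum_mul, hμ.2.1, one_mul]
    have h3 : n * (τ * jα) ≤ D + ∑ η, ν η * (step α τ)^[n] (fun _ => 0) η := by
      calc n * (τ * jα) = ∑ η, ν η * (n * (τ * jα)) := by
            rw [← Finset.sum_mul, hν.2.1, one_mul]
        _ ≤ ∑ η, ν η * (D + (step α τ)^[n] (fun _ => 0) η) :=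
            Finset.sum_le_sum fun η _ => mul_le_mul_of_nonneg_left (h2 η) (hν.1 η)
        _ = _ := by
            simp only [mul_add, Finset.sum_add_distrib]
            rw [← Finset.sum_mul, hν.2.1, one_mul]
    linarith
  by_contra hlt
  have hpos : 0 < τ * (jα - jβ) := mul_pos hτ (by linarith)
  obtain ⟨n, hn⟩ := exists_nat_gt (D / (τ * (jα - jβ)))
  rw [div_lt_iff₀ hpos] at hn
  linarith [hkey n]

end Monotonicity

/-! ### A product invariant measure -/

section Uniform

variable {x₁ x₂ : ℤ}

/-- Change the state of the site `x`. -/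
def flipSite (x : ℤ) (η : Config x₁ x₂) : Config x₁ x₂ :=
  fun y => if (y : ℤ) = x then !η y else η y

theorem flipSite_involutive (x : ℤ) : Function.Involutive (flipSite (x₁ := x₁) (x₂ := x₂) x) := by
  intro η
  funext y
  by_cases h : (y : ℤ) = x <;> simp [flipSite, h]

/-- Exchange the states of the sites `x` and `x + 1`. -/
def swapSites {x : ℤ} (hx : x ∈ Finset.Ico x₁ x₂) (η : Config x₁ x₂) : Config x₁ x₂ :=
  η ∘ Equiv.swap ⟨x, (Finset.mem_Ico.1 hx).1, (Finset.mem_Ico.1 hx).2.le⟩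
    ⟨x + 1, by have := (Finset.mem_Ico.1 hx).1; omega, (Finset.mem_Ico.1 hx).2⟩

theorem swapSites_involutive {x : ℤ} (hx : x ∈ Finset.Ico x₁ x₂) :
    Function.Involutive (swapSites hx) := by
  intro η
  funext y
  simp [swapSites]

/-- The jump `T` agrees with the involution `e` wherever its rate is nonzero, so a change of
variables moves the jump from `f` to the rate. -/
theorem sum_jump_eq (f c c' : Config x₁ x₂ → ℝ) (T e : Config x₁ x₂ → Config x₁ x₂)
    (he : Function.Involutive e) (hc : ∀ η, c (e η) = c' η)
    (hT : ∀ η, c η ≠ 0 → T η = e η) :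
    ∑ η, c η * (f (T η) - f η) = ∑ η, (c' η - c η) * f η := by
  have h : ∑ η, c η * f (T η) = ∑ η, c' η * f η := by
    rw [← Equiv.sum_comp he.toPerm fun η => c' η * f η]
    refine Finset.sum_congr rfl fun η _ => ?_
    have h1 : c' (e η) = c η := by rw [← hc, he]
    by_cases h0 : c η = 0
    · simp [h1, h0]
    · simp [h1, hT η h0]
  simp only [mul_sub, sub_mul, Finset.sum_sub_distrib, h]

theorem occ_flipSite {x : ℤ} (hx : x ∈ Set.Icc x₁ x₂) (η : Config x₁ x₂) :
    occ (flipSite x η) x = 1 - occ η x := by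
  simp only [occ, dif_pos hx, flipSite]
  cases η ⟨x, hx⟩ <;> simp

theorem setSite_eq_flipSite {x : ℤ} (hx : x ∈ Set.Icc x₁ x₂) (η : Config x₁ x₂) (b : Bool)
    (h : η ⟨x, hx⟩ = !b) : setSite η x b = flipSite x η := by
  funext y
  by_cases hy : (y : ℤ) = x
  · obtain rfl : y = ⟨x, hx⟩ := Subtype.ext hy
    simp [setSite, flipSite, h]
  · simp [setSite, flipSite, hy]

theorem sum_entrance (h12 : x₁ ≤ x₂) (f : Config x₁ x₂ → ℝ) :
    ∑ η : Config x₁ x₂, (1 - occ η x₁) * (f (setSite η x₁ true) - f η)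
      = ∑ η, (2 * occ η x₁ - 1) * f η := by
  have hx : x₁ ∈ Set.Icc x₁ x₂ := ⟨le_rfl, h12⟩
  rw [sum_jump_eq f (fun η => 1 - occ η x₁) (fun η => occ η x₁) _ _ (flipSite_involutive x₁)
    (fun η => by simp only [occ_flipSite hx]; ring)]
  · exact Finset.sum_congr rfl fun η _ => by ring
  · intro η h
    refine setSite_eq_flipSite hx η _ ?_
    by_contra hc
    exact h (by simp [occ, h12, show η ⟨x₁, hx⟩ = true by simpa using hc])

theorem sum_exit (h12 : x₁ ≤ x₂) (f : Config x₁ x₂ → ℝ) :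
    ∑ η : Config x₁ x₂, occ η x₂ * (f (setSite η x₂ false) - f η)
      = ∑ η, (1 - 2 * occ η x₂) * f η := by
  have hx : x₂ ∈ Set.Icc x₁ x₂ := ⟨h12, le_rfl⟩
  rw [sum_jump_eq f (fun η => occ η x₂) (fun η => 1 - occ η x₂) _ _ (flipSite_involutive x₂)
    (fun η => occ_flipSite hx η)]
  · exact Finset.sum_congr rfl fun η _ => by ring
  · intro η h
    refine setSite_eq_flipSite hx η _ ?_
    by_contra hc
    exact h (by simp [occ, h12, show η ⟨x₂, hx⟩ = false by simpa using hc])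

/-- The quadratic terms of the rate and of its swapped version cancel. What remains is a discrete
gradient, which telescopes over the box. -/
theorem sum_bulk {x : ℤ} (hx : x ∈ Finset.Ico x₁ x₂) (f : Config x₁ x₂ → ℝ) :
    ∑ η : Config x₁ x₂, occ η x * (1 - occ η (x + 1)) * (f (move η x) - f η)
      = ∑ η, (occ η (x + 1) - occ η x) * f η := by
  have hx' := Finset.mem_Ico.1 hx
  have h0 : x ∈ Set.Icc x₁ x₂ := ⟨hx'.1, hx'.2.le⟩
  have h1 : x + 1 ∈ Set.Icc x₁ x₂ := ⟨by omega, hx'.2⟩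
  have e0 : ∀ η : Config x₁ x₂, occ (swapSites hx η) x = occ η (x + 1) := by
    intro η; simp only [occ, dif_pos h0, dif_pos h1, swapSites, Function.comp_apply,
      Equiv.swap_apply_left]
  have e1 : ∀ η : Config x₁ x₂, occ (swapSites hx η) (x + 1) = occ η x := by
    intro η; simp only [occ, dif_pos h0, dif_pos h1, swapSites, Function.comp_apply,
      Equiv.swap_apply_right]
  rw [sum_jump_eq f (fun η => occ η x * (1 - occ η (x + 1)))
    (fun η => occ η (x + 1) * (1 - occ η x)) _ _ (swapSites_involutive hx)
    (fun η => by simp only [e0, e1])]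
  · exact Finset.sum_congr rfl fun η _ => by ring
  · intro η h
    have a0 : η ⟨x, h0⟩ = true := by
      by_contra hc
      exact h (by simp [occ, hx'.1, hx'.2.le, show η ⟨x, h0⟩ = false by simpa using hc])
    have a1 : η ⟨x + 1, h1⟩ = false := by
      by_contra hc
      have hc' : η ⟨x + 1, h1⟩ = true := by simpa using hc
      exact h (by rw [occ, occ, dif_pos h1, hc']; simp)
    funext y
    by_cases hy : (y : ℤ) = x
    · obtain rfl : y = ⟨x, h0⟩ := Subtype.ext hy
      simp [move, setSite, swapSites, a1]
    · by_cases hy' : (y : ℤ) = x + 1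
      · obtain rfl : y = ⟨x + 1, h1⟩ := Subtype.ext hy'
        simp [move, setSite, swapSites, a0]
      · have n0 : y ≠ ⟨x, h0⟩ := fun e => hy (congrArg Subtype.val e)
        have n1 : y ≠ ⟨x + 1, h1⟩ := fun e => hy' (congrArg Subtype.val e)
        simp [move, setSite, swapSites, hy, hy', Equiv.swap_apply_of_ne_of_ne n0 n1]

theorem sum_Ico_int_sub (g : ℤ → ℝ) (h12 : x₁ ≤ x₂) :
    ∑ x ∈ Finset.Ico x₁ x₂, (g (x + 1) - g x) = g x₂ - g x₁ := by
  induction x₂, h12 using Int.leInduction with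
  | base => simp
  | succ m hm ih =>
    have : Finset.Ico x₁ (m + 1) = insert m (Finset.Ico x₁ m) := by
      ext y; simp only [Finset.mem_Ico, Finset.mem_insert]; omega
    rw [this, Finset.sum_insert (by simp), ih]
    ring

/-! ### The comparison process and its current. -/

/-- The rates `s` in the bulk and `s / 2` at the entrance and at the exit. -/
noncomputable def halfBoundaryRate (x₁ x₂ : ℤ) (s : ℝ) (x : ℤ) : ℝ :=
  if x₁ ≤ x ∧ x < x₂ then s else s / 2

/-- The Bernoulli product measure of density `1 / 2`. -/
noncomputable def uniformMeasure (x₁ x₂ : ℤ) : Config x₁ x₂ → ℝ :=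
  fun _ => ((Fintype.card (Config x₁ x₂) : ℝ))⁻¹

theorem sum_uniformMeasure : ∑ η, uniformMeasure x₁ x₂ η = 1 := by
  simp [uniformMeasure]

/-- The boundary terms `(s / 2) (2 occ η x₁ - 1)` and `(s / 2) (1 - 2 occ η x₂)` cancel the
telescoped bulk term `s (occ η x₂ - occ η x₁)`. This dictates the boundary rate `s / 2`. -/
theorem isInvariant_uniformMeasure (h12 : x₁ ≤ x₂) (s : ℝ) :
    IsInvariant (halfBoundaryRate x₁ x₂ s) (uniformMeasure x₁ x₂) := by
  refine ⟨fun η => by unfold uniformMeasure; positivity, sum_uniformMeasure, fun f => ?_⟩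
  simp only [uniformMeasure]
  rw [← Finset.mul_sum]
  refine mul_eq_zero_of_right _ ?_
  have hb : ∀ η : Config x₁ x₂, ∑ x ∈ Finset.Ico x₁ x₂, halfBoundaryRate x₁ x₂ s x * occ η x *
      (1 - occ η (x + 1)) * (f (move η x) - f η)
      = s * ∑ x ∈ Finset.Ico x₁ x₂, occ η x * (1 - occ η (x + 1)) * (f (move η x) - f η) := by
    intro η
    rw [Finset.mul_sum]
    refine Finset.sum_congr rfl fun x hx => ?_
    rw [halfBoundaryRate, if_pos (Finset.mem_Ico.1 hx)]
    ring
  have hin : halfBoundaryRate x₁ x₂ s (x₁ - 1) = s / 2 := if_neg (by omega)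
  have hout : halfBoundaryRate x₁ x₂ s x₂ = s / 2 := if_neg (by omega)
  simp only [generator, hb, hin, hout, Finset.sum_add_distrib, mul_assoc (s / 2),
    ← Finset.mul_sum]
  rw [Finset.sum_comm, Finset.sum_congr rfl fun x hx => sum_bulk hx f, Finset.sum_comm,
    sum_entrance h12, sum_exit h12]
  have ht : ∀ η : Config x₁ x₂, ∑ x ∈ Finset.Ico x₁ x₂, (occ η (x + 1) - occ η x) * f η
      = (occ η x₂ - occ η x₁) * f η := by
    intro η
    rw [← Finset.sum_mul, sum_Ico_int_sub _ h12]
  simp only [ht, Finset.mul_sum, ← Finset.sum_add_distrib]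
  exact Finset.sum_eq_zero fun η _ => by ring

theorem current_uniformMeasure (h12 : x₁ ≤ x₂) (s : ℝ) :
    ∑ η, uniformMeasure x₁ x₂ η * (halfBoundaryRate x₁ x₂ s (x₁ - 1) * (1 - occ η x₁))
      = s / 4 := by
  have hin : halfBoundaryRate x₁ x₂ s (x₁ - 1) = s / 2 := if_neg (by omega)
  -- Applied to a constant function, the entrance identity says that the density at `x₁` is `1 / 2`.
  have h := sum_entrance h12 fun _ : Config x₁ x₂ => (uniformMeasure x₁ x₂ fun _ => true)
  simp only [sub_self, mul_zero, Finset.sum_const_zero] at h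
  have h1 := sum_uniformMeasure (x₁ := x₁) (x₂ := x₂)
  have h2 : ∑ η, uniformMeasure x₁ x₂ η * (halfBoundaryRate x₁ x₂ s (x₁ - 1) * (1 - occ η x₁))
      = s / 4 * ∑ η, uniformMeasure x₁ x₂ η
        - s / 4 * ∑ η : Config x₁ x₂, (2 * occ η x₁ - 1) * uniformMeasure x₁ x₂ (fun _ => true) := by
    rw [Finset.mul_sum, Finset.mul_sum, ← Finset.sum_sub_distrib]
    refine Finset.sum_congr rfl fun η _ => ?_
    rw [hin]
    simp only [uniformMeasure]
    ring
  rw [h2, h1, ← h]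
  ring

/-- If all rates are at least `s`, then the maximal current is at least `s / 4`. -/
theorem div_four_le_maxCurrent (h12 : x₁ ≤ x₂) {α : ℤ → ℝ} (hα : ∀ x, 0 < α x) {s : ℝ}
    (hs : 0 ≤ s) (hsα : ∀ x ∈ Finset.Icc (x₁ - 1) x₂, s ≤ α x) :
    s / 4 ≤ maxCurrent x₁ x₂ α := by
  rw [← current_uniformMeasure h12 s]
  refine stationaryCurrent_mono h12 (fun x _ => ?_) (fun x hx => le_trans ?_ (hsα x hx))
    (isInvariant_uniformMeasure h12 s) (isInvariant_invariantMeasure α hα)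
  · unfold halfBoundaryRate; split_ifs <;> linarith
  · unfold halfBoundaryRate; split_ifs <;> linarith

end Uniform

end TASEP

namespace TASEP

/-! ### The slow sites of the environment -/

section Environment

open MeasureTheory

variable (Q : Measure ℝ)

/-- The atom at `1` is not below `s`. Dropping the factor `ε` makes every later estimate uniform in
`ε`. -/
theorem siteLaw_Iio_le {ε s : ℝ} (hε : ε ≤ 1) (hs : s ≤ 1) :
    siteLaw Q ε (Set.Iio s) ≤ Q (Set.Iio s) := by
  have h1 : (1 : ℝ) ∉ Set.Iio s := not_lt.2 hs
  simp only [siteLaw, Measure.add_apply, Measure.smul_apply, smul_eq_mul,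
    Measure.dirac_apply' _ measurableSet_Iio, Set.indicator_of_notMem h1, mul_zero, zero_add]
  exact mul_le_of_le_one_left zero_le (ENNReal.ofReal_le_one.2 hε)

variable [IsProbabilityMeasure Q]

theorem environmentLaw_lt_le {ε s : ℝ} (h0 : 0 ≤ ε) (h1 : ε ≤ 1) (hs : s ≤ 1) (x : ℤ) :
    environmentLaw Q ε {α | α x < s} ≤ Q (Set.Iio s) := by
  have : IsProbabilityMeasure (siteLaw Q ε) := isProbabilityMeasure_siteLaw Q h0 h1
  have h := (measurePreserving_eval_infinitePi (fun _ : ℤ => siteLaw Q ε) x).measure_preimage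
    (measurableSet_Iio (a := s)).nullMeasurableSet
  exact h.le.trans (siteLaw_Iio_le Q h1 hs)

/-- The maximal current is below `s / 4` only if there is a site with rate below `s`. -/
theorem environmentLaw_maxCurrent_lt_le {r s ε : ℝ} (hr : 0 < r) (hrs : r ≤ s) (hs : s ≤ 1)
    (hQ : Q (Set.Iio r) = 0) (h0 : 0 ≤ ε) (h1 : ε ≤ 1) {N : ℕ} (hN : 1 ≤ N) :
    (environmentLaw Q ε).real {α : ℤ → ℝ | maxCurrent 1 (N : ℤ) α < s / 4}
      ≤ (N + 1) * Q.real (Set.Iio s) := by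
  -- The second union, over all of `ℤ`, is a null set. It is there because `div_four_le_maxCurrent`
  -- asks for positive rates outside the box too.
  have hsub : {α : ℤ → ℝ | maxCurrent 1 (N : ℤ) α < s / 4}
      ⊆ (⋃ x ∈ Finset.Icc (0 : ℤ) N, {α | α x < s}) ∪ ⋃ x : ℤ, {α | α x < r} := by
    intro α hα
    by_contra hc
    simp only [Set.mem_union, Set.mem_iUnion, Set.mem_ofPred_eq, not_or, not_exists, not_lt] at hc
    rw [Set.mem_ofPred_eq] at hα
    refine absurd hα (not_lt.2 ?_)
    exact div_four_le_maxCurrent (by exact_mod_cast hN) (fun x => hr.trans_le (hc.2 x))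
      (hr.le.trans hrs) fun x hx => hc.1 x (by simpa using hx)
  have hnull : environmentLaw Q ε (⋃ x : ℤ, {α | α x < r}) = 0 :=
    measure_iUnion_null fun x => le_antisymm
      ((environmentLaw_lt_le Q h0 h1 (hrs.trans hs) x).trans hQ.le) zero_le
  have hle : environmentLaw Q ε {α : ℤ → ℝ | maxCurrent 1 (N : ℤ) α < s / 4}
      ≤ (N + 1 : ℕ) * Q (Set.Iio s) := by
    refine (measure_mono hsub).trans ((measure_union_le _ _).trans ?_)
    rw [hnull, add_zero]
    refine (measure_biUnion_finset_le _ _).trans ?_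
    refine (Finset.sum_le_sum fun x _ => environmentLaw_lt_le Q h0 h1 hs x).trans ?_
    rw [Finset.sum_const, nsmul_eq_mul, Int.card_Icc]
    refine mul_le_mul_left (le_of_eq ?_) _
    congr 1
  have h := ENNReal.toReal_mono (ENNReal.mul_ne_top (ENNReal.natCast_ne_top _)
    (measure_ne_top _ _)) hle
  rw [ENNReal.toReal_mul, ENNReal.toReal_natCast] at h
  exact_mod_cast h

end Environment

end TASEP

/-! ### Choice of exponents and conclusion. -/

theorem mainTheorem6 (r R : ℝ) (hr : 0 < r) (hrR : r < R) (hR : R < 1)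
    (Q : MeasureTheory.Measure ℝ) [MeasureTheory.IsProbabilityMeasure Q]
    (hQ : Q (Set.Icc r R)ᶜ = 0) (hinf : IsGLB Q.support r)
    (κ : ℝ) (hκ : 1 < κ)
    (htail : (fun u : ℝ => Q.real (Set.Ico r (r + u)))
      =O[nhdsWithin 0 (Set.Ioi 0)] (fun u : ℝ => u ^ κ)) :
    TASEP.AssumptionH r Q := by
  have hκ0 : 0 < κ := by linarith
  have hQr : Q (Set.Iio r) = 0 :=
    MeasureTheory.measure_mono_null (t := (Set.Icc r R)ᶜ)
      (fun x hx h => absurd h.1 (not_le.2 hx)) hQ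
  obtain ⟨C, hC, hCt⟩ := htail.exists_pos
  obtain ⟨δ, hδ, hδt⟩ := (mem_nhdsGT_iff_exists_Ioo_subset.1 hCt.bound)
  have hδ : 0 < δ := hδ
  -- For `0 < u ≤ w` the tail bound applies, as `u < δ`, and `r + u ≤ 1`.
  set w : ℝ := min (δ / 2) (1 - r)
  have hw : 0 < w := lt_min (by linarith) (by linarith)
  -- With `b = 1 + 1 / κ` and `u = w N ^ (-b / 2)`, `N u ^ κ` is `w ^ κ N ^ (-(κ - 1) / 2)`, and `b
  -- < 2` is exactly `κ > 1`. Taking `a = w / 8` rather than `w / 4` turns the event `≤` into the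
  -- strict one. Uniformity in `ε` allows `ε₀ = 1`.
  refine ⟨1 + 1 / κ, w / 8, 2 * (C * w ^ κ), (κ - 1) / 2, ⟨by positivity, ?_⟩, by positivity,
    by positivity, by linarith, 1, by norm_num, fun ε hε N hN => ?_⟩
  · have : 1 / κ < 1 := (div_lt_one hκ0).2 hκ
    linarith
  have hN1 : (1 : ℝ) ≤ N := by exact_mod_cast hN
  have hN0 : (0 : ℝ) < N := by linarith
  set p : ℝ := (N : ℝ) ^ ((1 + 1 / κ) / 2)
  have hp : 1 ≤ p := Real.one_le_rpow hN1 (by positivity)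
  have hp0 : 0 < p := by linarith
  set u : ℝ := w / p
  have hu : 0 < u := by positivity
  have huw : u ≤ w := div_le_self hw.le hp
  have hu1 : u ≤ 1 - r := huw.trans (min_le_right _ _)
  have huδ : u < δ := by linarith [huw.trans (min_le_left _ _)]
  have hprob := TASEP.environmentLaw_maxCurrent_lt_le Q hr (s := r + u) (by linarith)
    (by linarith) hQr hε.1.le hε.2.le hN
  have htu : Q.real (Set.Iio (r + u)) ≤ C * u ^ κ := by
    have h1 : Q.real (Set.Ico r (r + u)) ≤ C * u ^ κ := by
      have h : ‖Q.real (Set.Ico r (r + u))‖ ≤ C * ‖u ^ κ‖ := hδt ⟨hu, huδ⟩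
      rwa [Real.norm_of_nonneg MeasureTheory.measureReal_nonneg,
        Real.norm_of_nonneg (by positivity)] at h
    have h2 : Q.real (Set.Iio r) = 0 := by rw [MeasureTheory.measureReal_def, hQr]; rfl
    have h3 := MeasureTheory.measureReal_union_le (μ := Q) (Set.Iio r) (Set.Ico r (r + u))
    rw [Set.Iio_union_Ico_eq_Iio (by linarith)] at h3
    linarith
  have hpκ : p ^ κ = N * (N : ℝ) ^ ((κ - 1) / 2) := by
    rw [← Real.rpow_mul hN0.le, ← Real.rpow_one_add' hN0.le (by linarith)]
    congr 1
    field_simp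
    ring
  calc (TASEP.environmentLaw Q ε).real
          {α : ℤ → ℝ | TASEP.maxCurrent 1 (N : ℤ) α ≤ r / 4 + w / 8 / p}
      ≤ (TASEP.environmentLaw Q ε).real
          {α : ℤ → ℝ | TASEP.maxCurrent 1 (N : ℤ) α < (r + u) / 4} := by
        have : MeasureTheory.IsProbabilityMeasure (TASEP.siteLaw Q ε) :=
          TASEP.isProbabilityMeasure_siteLaw Q hε.1.le hε.2.le
        have : MeasureTheory.IsProbabilityMeasure (TASEP.environmentLaw Q ε) := by
          unfold TASEP.environmentLaw; infer_instance
        refine MeasureTheory.measureReal_mono fun α hα => ?_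
        rw [Set.mem_ofPred_eq] at hα ⊢
        refine hα.trans_lt ?_
        rw [show w / 8 / p = u / 8 by simp only [u]; ring]
        linarith
    _ ≤ (N + 1) * (C * u ^ κ) :=
        hprob.trans (mul_le_mul_of_nonneg_left htu (by linarith))
    _ ≤ 2 * N * (C * u ^ κ) := mul_le_mul_of_nonneg_right (by linarith) (by positivity)
    _ = 2 * (C * w ^ κ) / (N : ℝ) ^ ((κ - 1) / 2) := by
        rw [Real.div_rpow hw.le hp0.le, hpκ]
        field_simp
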